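/- Setting. Let $u(t)\in\mathbb{R}^m$ and $e(t)\in\mathbb{R}^p$ ($t\in\mathbb{Z}$) be jointly quasi-stationary signals: with $\kappa(t)=\begin{bmatrix}u(t)\\e(t)\end{bmatrix}$, the second moments of $\kappa(t)$ are bounded uniformly in $t$ and the correlations $R_\kappa(\tau)=\bar{\mathbb{E}}\,\kappa(t)\kappa(t-\tau)^T$ exist for all $\tau\in\mathbb{Z}$, where $\bar{\mathbb{E}}f(t):=\lim_{N\to\infty}\frac1N\sum_{t=1}^N\mathbb{E}f(t)$. Let $e$ be white noise ($\bar{\mathbb{E}}\,e(t)e(t-\tau)^T=0$ for $\tau\neq0$), uncorrelated with present and past inputs ($\bar{\mathbb{E}}\,e(t)u(t-\tau)^T=0$ for $\tau\ge0$). A transfer matrix is a matrix of causal linear time-invariant filters $\sum_{k\ge0}g_kq^{-k}$ with real coefficients (for instance proper rational ones); it is stable if every entry has $\sum_k|g_k|<\infty$, and a square one is monic if its coefficient at $q^0$ is $I$. The data are generated by $$y(t)=G^0(q)u(t)+H^0(q)e(t),$$ with $G^0$ ($p\times m$) stable and $H^0$ ($p\times p$) monic, stable and stably invertible. Consider a parametrized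 model set $M(q,\theta)=[G(q,\theta)\ \ H(q,\theta)]$, $\theta\in\Theta\subset\mathbb{R}^n$, with $G(q,\theta)$ stable and $H(q,\theta)$ monic, stable and stably invertible for every $\theta\in\Theta$, which contains the system: $M(q,\theta_0)=M^0(q):=[G^0(q)\ \ H^0(q)]$ for some $\theta_0\in\Theta$. Let $$\varepsilon(t,\theta)=y(t)-\Big[\big(I-H(q,\theta)^{-1}\big)y(t)+H(q,\theta)^{-1}G(q,\theta)u(t)\Big],\qquad V(\theta)=\bar{\mathbb{E}}\,\varepsilon(t,\theta)^TQ\,\varepsilon(t,\theta),$$ be the one-step-ahead prediction error and the prediction-error cost, with $Q$ any positive definite weighting matrix. For $\ell=1,\dots,p$ let $\kappa^{[\ell]}$ be the vector of those components $\kappa_j$ of $\kappa$ for which the entry $M_{\ell j}(q,\theta)$ is not structurally zero, i.e. is nonzero for some $\theta\in\Theta$. Suppose that $\kappa^{[\ell]}$ has a spectrum $\Phi_{\kappa^{[\ell]}}$, i.e. an integrable matrix function on $(-\pi,\pi]$ with $\bar{\mathbb{E}}\,\kappa^{[\ell]}(t)\kappa^{[\ell]}(t-\tau)^T=\frac1{2\pi}\int_{-\pi}^{\pi}\Phi_{\kappa^{[\ell]}}(\omega)e^{i\omega\tau}\,d\omega$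 for all $\tau\in\mathbb{Z}$. Proposition. Suppose the rows $M_\ell(q,\theta)$ of the model are independently parametrized, i.e. no two rows depend on a common component of $\theta$. If, for every $\ell=1,\dots,p$, $\Phi_{\kappa^{[\ell]}}(\omega)\succ0$ for almost all $\omega$, then the cost $V(\theta)$ exists for all $\theta\in\Theta$, and $M(q,\theta)=M^0(q)$ is its unique minimum: a parameter $\theta\in\Theta$ minimizes $V$ over $\Theta$ if and only if $M(q,\theta)=M^0(q)$. -/

import Mathlib

open MeasureTheory Filter Topology

open scoped Matrix ComplexOrder

noncomputable section

namespace PredErr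

/-- A transfer function of a causal linear time-invariant system is represented by its expansion
`g₀ + g₁ q⁻¹ + g₂ q⁻² + ⋯` in the delay operator `X = q⁻¹`; the coefficients are the impulse
response.  Every proper rational transfer function has such an expansion. -/
abbrev TF : Type := PowerSeries ℝ

/-- A vector signal in discrete time: time, then realization, then component.  A deterministic
signal is one on a one-point probability space, and a signal that starts at a finite time is
extended by zero. -/
abbrev Signal (Ω : Type*) (ι : Type*) : Type _ := ℤ → Ω → ι → ℝ

/-- Stability of a transfer matrix: all impulse responses are absolutely summable.  For rational
entries this says exactly that all poles lie in the open unit disc. -/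
def IsStable {α β : Type*} (F : Matrix α β TF) : Prop :=
  ∀ i j, Summable fun k : ℕ => |PowerSeries.coeff k (F i j)|

/-- A square transfer matrix is monic if its direct feed-through term is the identity. -/
def IsMonic {α : Type*} [DecidableEq α] (H : Matrix α α TF) : Prop :=
  H.map PowerSeries.constantCoeff = 1

/-- The standing assumptions on a pair `(G, H)`: `G` is stable, and `H` is monic, stable and stably
invertible.  (A monic matrix is invertible over the power series, so `H⁻¹` is its true inverse.) -/
structure IsAdmissible {p m : ℕ} (G : Matrix (Fin p) (Fin m) TF)
    (H : Matrix (Fin p) (Fin p) TF) : Prop where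
  stable_G : IsStable G
  monic_H : IsMonic H
  stable_H : IsStable H
  stable_H_inv : IsStable H⁻¹

/-- The filtered signal `F(q) s(t) = ∑ₖ Fₖ s(t - k)`. -/
def filt {Ω α β : Type*} [Fintype β] (F : Matrix α β TF) (s : Signal Ω β) : Signal Ω α :=
  fun t ω i => ∑ j, ∑' k : ℕ, PowerSeries.coeff k (F i j) * s (t - k) ω j

/-- The combined matrix `M = [G H]`. -/
abbrev combined {p m : ℕ} (G : Matrix (Fin p) (Fin m) TF) (H : Matrix (Fin p) (Fin p) TF) :
    Matrix (Fin p) (Fin m ⊕ Fin p) TF :=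
  Matrix.fromCols G H

/-- Stacking of two vector signals. -/
def stack {Ω α β : Type*} (u : Signal Ω α) (e : Signal Ω β) : Signal Ω (α ⊕ β) :=
  fun t ω => Sum.elim (u t ω) (e t ω)

/-- The predictor filter `W = [I - H⁻¹   H⁻¹ G]`. -/
def predictorFilter {p m : ℕ} (G : Matrix (Fin p) (Fin m) TF) (H : Matrix (Fin p) (Fin p) TF) :
    Matrix (Fin p) (Fin p ⊕ Fin m) TF :=
  Matrix.fromCols (1 - H⁻¹) (H⁻¹ * G)

/-- The one-step-ahead prediction error `ε(t) = y(t) - W(q) z(t)`, `z = (y, u)`. -/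
def predictionError {Ω : Type*} {p m : ℕ} (G : Matrix (Fin p) (Fin m) TF)
    (H : Matrix (Fin p) (Fin p) TF) (y : Signal Ω (Fin p)) (u : Signal Ω (Fin m)) :
    Signal Ω (Fin p) :=
  fun t ω => y t ω - filt (predictorFilter G H) (stack y u) t ω

variable {Ω : Type*} [MeasurableSpace Ω]

/-- The generalized expectation `Ē f(t) = lim_{N → ∞} (1/N) ∑_{t=1}^N E f(t)` exists and equals
`v`. -/
def HasGenExp (P : Measure Ω) (f : ℤ → Ω → ℝ) (v : ℝ) : Prop :=
  (∀ t, Integrable (f t) P) ∧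
    Tendsto (fun N : ℕ => (N : ℝ)⁻¹ * ∑ t ∈ Finset.Icc (1 : ℤ) N, ∫ ω, f t ω ∂P) atTop (𝓝 v)

/-- `R` is the correlation function of `s`: `R(τ) = Ē s(t) s(t - τ)ᵀ`. -/
def IsCorrelation {ι : Type*} (P : Measure Ω) (s : Signal Ω ι) (R : ℤ → Matrix ι ι ℝ) : Prop :=
  ∀ (τ : ℤ) (i j : ι), HasGenExp P (fun t ω => s t ω i * s (t - τ) ω j) (R τ i j)

/-- Quasi-stationary signals: second moments bounded uniformly in time (hence bounded means), and
all correlations `Ē s(t) s(t - τ)ᵀ` exist. -/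
structure IsQuasiStationary {ι : Type*} (P : Measure Ω) (s : Signal Ω ι) : Prop where
  memLp : ∀ t i, MemLp (fun ω => s t ω i) 2 P
  bounded : ∃ C : ℝ, ∀ t i, ∫ ω, (s t ω i) ^ 2 ∂P ≤ C
  correlation : ∃ R : ℤ → Matrix ι ι ℝ, IsCorrelation P s R

/-- `Φ` is the spectrum (spectral density matrix) of `s`: an integrable function on `(-π, π]`
whose Fourier series is `∑_τ R(τ) e^{-iωτ}`, where `R` is the correlation function of `s`. -/
def IsSpectrum {ι : Type*} (P : Measure Ω) (s : Signal Ω ι) (Φ : ℝ → Matrix ι ι ℂ) : Prop :=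
  (∀ i j, IntervalIntegrable (fun w => Φ w i j) volume (-Real.pi) Real.pi) ∧
    ∃ R : ℤ → Matrix ι ι ℝ, IsCorrelation P s R ∧
      ∀ (τ : ℤ) (i j : ι), (R τ i j : ℂ) =
        (2 * Real.pi : ℂ)⁻¹ *
          ∫ w in (-Real.pi)..Real.pi, Complex.exp (Complex.I * w * τ) * Φ w i j

/-- `Φ(ω) ≻ 0` for almost all frequencies. -/
def PosDefAE {ι : Type*} (Φ : ℝ → Matrix ι ι ℂ) : Prop :=
  ∀ᵐ w ∂(volume.restrict (Set.Ioc (-Real.pi) Real.pi)), (Φ w).PosDef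

/-- Whiteness: `Ē e(t) e(t - τ)ᵀ = 0` for all `τ ≠ 0`.  It holds in particular whenever
`E e(t) e(s)ᵀ = 0` for all `t ≠ s`. -/
def IsWhite {ι : Type*} (P : Measure Ω) (e : Signal Ω ι) : Prop :=
  ∀ τ : ℤ, τ ≠ 0 → ∀ i j, HasGenExp P (fun t ω => e t ω i * e (t - τ) ω j) 0

/-- `e(t)` is uncorrelated with the present and past input `uᵗ`: `Ē e(t) u(t - τ)ᵀ = 0` for all
`τ ≥ 0`.  It holds when `u` and `e` are uncorrelated (open loop), and for inputs generated by
delayed feedback from the outputs and signals uncorrelated with `e`. -/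
def IsUncorrelatedWithPast {α β : Type*} (P : Measure Ω) (e : Signal Ω α) (u : Signal Ω β) :
    Prop :=
  ∀ τ : ℤ, 0 ≤ τ → ∀ i j, HasGenExp P (fun t ω => e t ω i * u (t - τ) ω j) 0

variable {n p : ℕ} {κ : Type*}

/-- The rows of `M(q, θ)`, `θ ∈ Θ`, are independently parametrized: there are pairwise disjoint
sets of components of `θ` such that row `ℓ` depends only on the components in the `ℓ`-th set. -/
def IndependentRows (Θ : Set (Fin n → ℝ)) (M : (Fin n → ℝ) → Matrix (Fin p) κ TF) : Prop :=
  ∃ I : Fin p → Set (Fin n), Pairwise (fun ℓ ℓ' => Disjoint (I ℓ) (I ℓ')) ∧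
    ∀ ℓ, ∀ θ ∈ Θ, ∀ θ' ∈ Θ, (∀ i ∈ I ℓ, θ i = θ' i) → M θ ℓ = M θ' ℓ

/-- The columns of the entries of row `ℓ` that are not identically zero in the model set. -/
def rowSupport (Θ : Set (Fin n → ℝ)) (M : (Fin n → ℝ) → Matrix (Fin p) κ TF) (ℓ : Fin p) : Set κ :=
  {j | ∃ θ ∈ Θ, M θ ℓ j ≠ 0}

/-- The sub-vector of a signal with components in `S`. -/
def subSignal {Ω κ : Type*} (s : Signal Ω κ) (S : Set κ) : Signal Ω S :=
  fun t ω j => s t ω j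

end PredErr

end

/-!
Write `M = [G H]`, `M⁰ = [G⁰ H⁰]` and `κ = (u, e)`. The prediction error of the model `M` is
`ε = e + H⁻¹ (M⁰ - M) κ`. Since `H` and `H⁰` are monic, the second term only involves past noise
and present and past inputs, so it is uncorrelated with `e`, and the cost is the cost of `e` plus
the `Q`-weighted power of `H⁻¹ (M⁰ - M) κ`.

Equality with the cost of `e` therefore means that `H⁻¹ (M⁰ - M) κ` has zero power. Filtering by
the stable `H` preserves zero power, so `d κ` has zero power for every row `d` of `M⁰ - M`. This
power is `(1/2π) ∫ D* Φ D` with `D` the frequency response of `d`, which positivity of the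
spectrum `Φ` forces to vanish almost everywhere.
-/

namespace PredErr

open scoped BoundedContinuousFunction

/-- The transfer functions with absolutely summable impulse response. -/
def stableTF : Subring TF where
  carrier := {f | Summable fun k : ℕ => |PowerSeries.coeff k f|}
  mul_mem' {f g} hf hg := by
    simpa [PowerSeries.coeff_mul] using summable_norm_sum_mul_antidiagonal_of_summable_norm
      (f := fun k => PowerSeries.coeff k f) (g := fun k => PowerSeries.coeff k g) hf hg
  one_mem' := summable_of_ne_finset_zero (s := {0}) fun k hk => by
    simp [PowerSeries.coeff_one, Finset.notMem_singleton.1 hk]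
  add_mem' {f g} hf hg := Summable.of_nonneg_of_le (fun _ => abs_nonneg _)
    (fun k => by simpa using abs_add_le (PowerSeries.coeff k f) (PowerSeries.coeff k g))
    (Summable.add hf hg)
  zero_mem' := by simp
  neg_mem' hf := by simpa using hf

section IsStable

variable {α β γ : Type*} {F F' : Matrix α β TF}

theorem IsStable.mem_stableTF (hF : IsStable F) (i : α) (j : β) : F i j ∈ stableTF := hF i j

theorem IsStable.sub (hF : IsStable F) (hF' : IsStable F') : IsStable (F - F') :=
  fun i j => sub_mem (hF.mem_stableTF i j) (hF'.mem_stableTF i j)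

theorem IsStable.mul [Fintype β] {K : Matrix β γ TF} (hF : IsStable F) (hK : IsStable K) :
    IsStable (F * K) :=
  fun i j => sum_mem (S := stableTF) fun l _ => mul_mem (hF i l) (hK l j)

theorem isStable_one [DecidableEq α] : IsStable (1 : Matrix α α TF) := fun i j => by
  change (1 : Matrix α α TF) i j ∈ stableTF
  rw [Matrix.one_apply]
  split_ifs
  exacts [one_mem _, zero_mem _]

theorem IsStable.fromCols {K : Matrix α γ TF} (hF : IsStable F) (hK : IsStable K) :
    IsStable (Matrix.fromCols F K)
  | i, .inl j => hF i j
  | i, .inr j => hK i j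

end IsStable

section Evaluation

variable {A : Type*} [NormedRing A] [NormedAlgebra ℝ A] {T : A}

/-- The value `f(T) = ∑ₖ fₖ Tᵏ` of a transfer function at an element of a normed algebra. It is
meaningful for `f ∈ stableTF` and power-bounded `T`, where the series converges absolutely. -/
noncomputable def evalAt (T : A) (f : TF) : A :=
  ∑' k : ℕ, PowerSeries.coeff k f • T ^ k

@[simp]
theorem evalAt_zero : evalAt T 0 = 0 := by
  simp [evalAt]

@[simp]
theorem evalAt_one : evalAt T 1 = 1 := by
  rw [evalAt, tsum_eq_single 0 fun k hk => by simp [PowerSeries.coeff_one, hk]]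
  simp

variable {f g : TF}

theorem summable_norm_coeff_smul_pow (hT : ∀ k, ‖T ^ k‖ ≤ 1) (hf : f ∈ stableTF) :
    Summable fun k : ℕ => ‖PowerSeries.coeff k f • T ^ k‖ :=
  Summable.of_nonneg_of_le (fun _ => norm_nonneg _)
    (fun k => by simpa [norm_smul] using mul_le_mul_of_nonneg_left (hT k) (abs_nonneg _)) hf

variable [CompleteSpace A]

theorem hasSum_evalAt (hT : ∀ k, ‖T ^ k‖ ≤ 1) (hf : f ∈ stableTF) :
    HasSum (fun k : ℕ => PowerSeries.coeff k f • T ^ k) (evalAt T f) :=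
  (summable_norm_coeff_smul_pow hT hf).of_norm.hasSum

theorem evalAt_add (hT : ∀ k, ‖T ^ k‖ ≤ 1) (hf : f ∈ stableTF) (hg : g ∈ stableTF) :
    evalAt T (f + g) = evalAt T f + evalAt T g := by
  rw [← ((hasSum_evalAt hT hf).add (hasSum_evalAt hT hg)).tsum_eq]
  simp only [evalAt, map_add, add_smul]

theorem evalAt_mul (hT : ∀ k, ‖T ^ k‖ ≤ 1) (hf : f ∈ stableTF) (hg : g ∈ stableTF) :
    evalAt T (f * g) = evalAt T f * evalAt T g := by
  rw [evalAt, evalAt, evalAt, tsum_mul_tsum_eq_tsum_sum_antidiagonal_of_summable_norm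
    (summable_norm_coeff_smul_pow hT hf) (summable_norm_coeff_smul_pow hT hg)]
  refine tsum_congr fun n => ?_
  rw [PowerSeries.coeff_mul, Finset.sum_smul]
  refine Finset.sum_congr rfl fun kl hkl => ?_
  rw [smul_mul_smul_comm, ← pow_add, Finset.HasAntidiagonal.mem_antidiagonal.1 hkl]

/-- Evaluation at an element with powers of norm at most `1`, as a ring homomorphism on stable
transfer functions. -/
noncomputable def evalAtHom (hT : ∀ k, ‖T ^ k‖ ≤ 1) : stableTF →+* A where
  toFun f := evalAt T f
  map_zero' := evalAt_zero
  map_one' := evalAt_one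
  map_add' f g := evalAt_add hT f.2 g.2
  map_mul' f g := evalAt_mul hT f.2 g.2

theorem hasSum_evalAt_apply {X : Type*} [NormedAddCommGroup X] [NormedSpace ℝ X] [CompleteSpace X]
    {T : X →L[ℝ] X} (hT : ∀ k, ‖T ^ k‖ ≤ 1) (hf : f ∈ stableTF) (x : X) :
    HasSum (fun k : ℕ => PowerSeries.coeff k f • (T ^ k) x) (evalAt T f x) :=
  (hasSum_evalAt hT hf).mapL (ContinuousLinearMap.apply ℝ X x)

end Evaluation

section Filter

variable {E : Type*} [NormedAddCommGroup E] [NormedSpace ℝ E]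

/-- The delay operator `q⁻ᵏ` on bounded sequences, `(q⁻ᵏ x)(t) = x(t - k)`. -/
noncomputable def delay (k : ℤ) : (ℤ →ᵇ E) →L[ℝ] (ℤ →ᵇ E) :=
  BoundedContinuousFunction.compContinuousCLM E ℝ ⟨fun t => t - k, continuous_of_discreteTopology⟩

@[simp]
theorem delay_apply (k : ℤ) (x : ℤ →ᵇ E) (t : ℤ) : delay k x t = x (t - k) := rfl

@[simp]
theorem delay_zero : delay 0 = ContinuousLinearMap.id ℝ (ℤ →ᵇ E) := by
  ext x t
  simp

theorem delay_delay (k l : ℤ) (x : ℤ →ᵇ E) : delay k (delay l x) = delay (k + l) x := by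
  ext t
  simp [sub_sub]

theorem delay_one_pow (k : ℕ) : (delay 1 : (ℤ →ᵇ E) →L[ℝ] (ℤ →ᵇ E)) ^ k = delay k := by
  induction k with
  | zero => simp [ContinuousLinearMap.one_def]
  | succ k ih =>
    ext1 x
    rw [pow_succ, ih, mul_apply_eq_comp, delay_delay, Nat.cast_succ]

theorem norm_delay_one_pow_le (k : ℕ) : ‖(delay 1 : (ℤ →ᵇ E) →L[ℝ] (ℤ →ᵇ E)) ^ k‖ ≤ 1 := by
  rw [delay_one_pow]
  exact BoundedContinuousFunction.norm_compContinuousCLM_le_one _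

theorem summable_norm_coeff_smul_delay {f : TF} (hf : f ∈ stableTF) (x : ℤ →ᵇ E) :
    Summable fun k : ℕ => ‖PowerSeries.coeff k f • delay k x‖ :=
  (hf.mul_right ‖x‖).of_nonneg_of_le (fun _ => norm_nonneg _) fun k => by
    rw [norm_smul, Real.norm_eq_abs]
    gcongr
    exact (BoundedContinuousFunction.norm_le (norm_nonneg x)).2 fun t => x.norm_coe_le_norm _

/-- The filter `f(q) = ∑ₖ fₖ q⁻ᵏ` as an operator on bounded sequences, for `f ∈ stableTF`. -/
noncomputable def filterCLM (f : TF) : (ℤ →ᵇ E) →L[ℝ] (ℤ →ᵇ E) :=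
  evalAt (delay 1) f

@[simp]
theorem filterCLM_zero : filterCLM 0 = (0 : (ℤ →ᵇ E) →L[ℝ] (ℤ →ᵇ E)) := evalAt_zero

@[simp]
theorem filterCLM_one : filterCLM 1 = (1 : (ℤ →ᵇ E) →L[ℝ] (ℤ →ᵇ E)) := evalAt_one

/-- The transfer matrix `F(q)` as an operator on vectors of bounded sequences. -/
noncomputable def matFilter {α β : Type*} [Fintype β] (F : Matrix α β TF) :
    (β → ℤ →ᵇ E) →ₗ[ℝ] (α → ℤ →ᵇ E) :=
  LinearMap.pi fun i => ∑ j, (filterCLM (F i j)).toLinearMap ∘ₗ LinearMap.proj j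

theorem matFilter_apply {α β : Type*} [Fintype β] (F : Matrix α β TF) (x : β → ℤ →ᵇ E) (i : α) :
    matFilter F x i = ∑ j, filterCLM (F i j) (x j) := by
  simp [matFilter]

theorem matFilter_one {α : Type*} [Fintype α] [DecidableEq α] (x : α → ℤ →ᵇ E) :
    matFilter 1 x = x := by
  ext1 i
  rw [matFilter_apply, Finset.sum_eq_single i fun j _ hj => by simp [Matrix.one_apply_ne hj.symm]]
    <;> simp

theorem matFilter_fromCols {α β γ : Type*} [Fintype β] [Fintype γ] (F : Matrix α β TF)
    (K : Matrix α γ TF) (x : β ⊕ γ → ℤ →ᵇ E) :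
    matFilter (Matrix.fromCols F K) x =
      matFilter F (x ∘ Sum.inl) + matFilter K (x ∘ Sum.inr) := by
  ext1 i
  simp [matFilter_apply, Fintype.sum_sum_type]

variable [CompleteSpace E] {f g : TF}

theorem hasSum_filterCLM_apply (hf : f ∈ stableTF) (x : ℤ →ᵇ E) :
    HasSum (fun k : ℕ => PowerSeries.coeff k f • delay k x) (filterCLM f x) := by
  have hsum := hasSum_evalAt_apply norm_delay_one_pow_le hf x
  simp only [delay_one_pow] at hsum
  exact hsum

theorem filterCLM_apply_apply (hf : f ∈ stableTF) (x : ℤ →ᵇ E) (t : ℤ) :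
    filterCLM f x t = ∑' k : ℕ, PowerSeries.coeff k f • x (t - k) :=
  ((hasSum_filterCLM_apply hf x).mapL (BoundedContinuousFunction.evalCLM ℝ t)).tsum_eq.symm

theorem delay_filterCLM (hf : f ∈ stableTF) (k : ℤ) (x : ℤ →ᵇ E) :
    delay k (filterCLM f x) = filterCLM f (delay k x) := by
  ext t
  simp only [delay_apply, filterCLM_apply_apply hf, sub_right_comm]

/-- `filterCLM` as a ring homomorphism on stable transfer functions. -/
noncomputable def filterHom (E : Type*) [NormedAddCommGroup E] [NormedSpace ℝ E]
    [CompleteSpace E] : stableTF →+* ((ℤ →ᵇ E) →L[ℝ] (ℤ →ᵇ E)) :=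
  evalAtHom norm_delay_one_pow_le

section matFilter

variable {α β γ : Type*} [Fintype β] {F F' : Matrix α β TF}

theorem matFilter_sub (hF : IsStable F) (hF' : IsStable F') (x : β → ℤ →ᵇ E) :
    matFilter (F - F') x = matFilter F x - matFilter F' x := by
  ext1 i
  have hentry (j : β) : filterCLM ((F - F') i j) (x j) =
      filterCLM (F i j) (x j) - filterCLM (F' i j) (x j) :=
    DFunLike.congr_fun (map_sub (filterHom E) ⟨_, hF i j⟩ ⟨_, hF' i j⟩) (x j)
  simp only [matFilter_apply, Pi.sub_apply, hentry, Finset.sum_sub_distrib]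

theorem matFilter_mul [Fintype α] {K : Matrix γ α TF} (hK : IsStable K) (hF : IsStable F)
    (x : β → ℤ →ᵇ E) : matFilter (K * F) x = matFilter K (matFilter F x) := by
  ext1 i
  have hentry (j : β) : filterCLM ((K * F) i j) (x j) =
      ∑ l, filterCLM (K i l) (filterCLM (F l j) (x j)) := by
    have hsum : (⟨(K * F) i j, hK.mul hF i j⟩ : stableTF) =
        ∑ l, ⟨K i l, hK i l⟩ * ⟨F l j, hF l j⟩ := by
      ext1
      simp [Matrix.mul_apply]
    have happly := DFunLike.congr_fun (congrArg (filterHom E) hsum) (x j)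
    simp only [map_sum, map_mul, sum_apply, mul_apply_eq_comp] at happly
    exact happly
  simp only [matFilter_apply, hentry, map_sum]
  exact Finset.sum_comm

end matFilter

end Filter

section MeanInner

variable {E : Type*} [NormedAddCommGroup E] [InnerProductSpace ℝ E] {a b : ℤ →ᵇ E} {v : ℝ}

/-- The time average `(1/N) ∑_{t=1}^N ⟪a(t), b(t)⟫`, as a continuous bilinear form. -/
noncomputable def avgInner (N : ℕ) : (ℤ →ᵇ E) →L[ℝ] (ℤ →ᵇ E) →L[ℝ] ℝ :=
  (N : ℝ)⁻¹ • ∑ t ∈ Finset.Icc (1 : ℤ) N, (innerSL ℝ).bilinearComp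
    (BoundedContinuousFunction.evalCLM ℝ t) (BoundedContinuousFunction.evalCLM ℝ t)

theorem avgInner_apply (N : ℕ) (a b : ℤ →ᵇ E) :
    avgInner N a b = (N : ℝ)⁻¹ * ∑ t ∈ Finset.Icc (1 : ℤ) N, inner ℝ (a t) (b t) := by
  simp [avgInner]

theorem avgInner_comm (N : ℕ) (a b : ℤ →ᵇ E) : avgInner N a b = avgInner N b a := by
  simp only [avgInner_apply, real_inner_comm]

theorem abs_inner_apply_le (a b : ℤ →ᵇ E) (t : ℤ) : |inner ℝ (a t) (b t)| ≤ ‖a‖ * ‖b‖ :=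
  (abs_real_inner_le_norm _ _).trans
    (mul_le_mul (a.norm_coe_le_norm t) (b.norm_coe_le_norm t) (norm_nonneg _) (norm_nonneg _))

theorem abs_avgInner_le (N : ℕ) (a b : ℤ →ᵇ E) : |avgInner N a b| ≤ ‖a‖ * ‖b‖ := by
  rw [avgInner_apply, abs_mul, abs_of_nonneg (by positivity : (0 : ℝ) ≤ (N : ℝ)⁻¹)]
  calc _ ≤ (N : ℝ)⁻¹ * ∑ _t ∈ Finset.Icc (1 : ℤ) N, ‖a‖ * ‖b‖ := by
        gcongr
        exact (Finset.abs_sum_le_sum_abs _ _).trans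
          (Finset.sum_le_sum fun t _ => abs_inner_apply_le a b t)
    _ = ((N : ℝ)⁻¹ * N) * (‖a‖ * ‖b‖) := by simp [mul_assoc]
    _ ≤ ‖a‖ * ‖b‖ := mul_le_of_le_one_left (by positivity) inv_mul_le_one

theorem avgInner_self_nonneg (N : ℕ) (a : ℤ →ᵇ E) : 0 ≤ avgInner N a a := by
  rw [avgInner_apply]
  exact mul_nonneg (by positivity) (Finset.sum_nonneg fun t _ => real_inner_self_nonneg)

theorem avgInner_sq_le (N : ℕ) (a b : ℤ →ᵇ E) :
    avgInner N a b ^ 2 ≤ avgInner N a a * avgInner N b b := by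
  have hsum : (∑ t ∈ Finset.Icc (1 : ℤ) N, inner ℝ (a t) (b t)) ^ 2 ≤
      (∑ t ∈ Finset.Icc (1 : ℤ) N, ‖a t‖ ^ 2) * ∑ t ∈ Finset.Icc (1 : ℤ) N, ‖b t‖ ^ 2 := by
    refine le_trans (sq_le_sq.2 ?_) (Finset.sum_mul_sq_le_sq_mul_sq _ (‖a ·‖) (‖b ·‖))
    exact (Finset.abs_sum_le_sum_abs _ _).trans ((Finset.sum_le_sum fun t _ =>
      abs_real_inner_le_norm _ _).trans (le_abs_self _))
  simp only [avgInner_apply, real_inner_self_eq_norm_sq]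
  calc _ = (N : ℝ)⁻¹ ^ 2 * (∑ t ∈ Finset.Icc (1 : ℤ) N, inner ℝ (a t) (b t)) ^ 2 := mul_pow ..
    _ ≤ _ := mul_le_mul_of_nonneg_left hsum (sq_nonneg _)
    _ = _ := by ring

theorem avgInner_delay_one (N : ℕ) (a b : ℤ →ᵇ E) :
    avgInner N (delay 1 a) (delay 1 b) =
      avgInner N a b + (N : ℝ)⁻¹ * (inner ℝ (a 0) (b 0) - inner ℝ (a N) (b N)) := by
  have htelescope : ∑ t ∈ Finset.Icc (1 : ℤ) N, inner ℝ (a (t - 1)) (b (t - 1)) =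
      (∑ t ∈ Finset.Icc (1 : ℤ) N, inner ℝ (a t) (b t)) +
        (inner ℝ (a 0) (b 0) - inner ℝ (a N) (b N)) := by
    induction N with
    | zero => simp
    | succ N ih =>
      have hinsert : insert ((N : ℤ) + 1) (Finset.Icc 1 (N : ℤ)) = Finset.Icc 1 ((N : ℤ) + 1) :=
        Finset.insert_Icc_right_eq_Icc_add_one (by lia)
      have hnotMem : (N : ℤ) + 1 ∉ Finset.Icc 1 (N : ℤ) := by simp
      rw [Nat.cast_succ, ← hinsert, Finset.sum_insert hnotMem, Finset.sum_insert hnotMem, ih,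
        add_sub_cancel_right]
      ring
  rw [avgInner_apply, avgInner_apply, ← mul_add, ← htelescope]
  rfl

/-- `Ē ⟪a(t), b(t)⟫ = v`: the time averages of the inner products converge to `v`. -/
def HasMeanInner (a b : ℤ →ᵇ E) (v : ℝ) : Prop :=
  Tendsto (fun N => avgInner N a b) atTop (𝓝 v)

theorem HasMeanInner.symm (h : HasMeanInner a b v) : HasMeanInner b a v := by
  simpa only [HasMeanInner, avgInner_comm] using h

theorem HasMeanInner.smul_right (h : HasMeanInner a b v) (r : ℝ) :
    HasMeanInner a (r • b) (r * v) := by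
  simpa [HasMeanInner] using h.const_mul r

theorem HasMeanInner.sum_right {ι : Type*} {s : Finset ι} {b : ι → ℤ →ᵇ E} {v : ι → ℝ}
    (h : ∀ i ∈ s, HasMeanInner a (b i) (v i)) : HasMeanInner a (∑ i ∈ s, b i) (∑ i ∈ s, v i) := by
  simpa only [HasMeanInner, map_sum] using tendsto_finsetSum s h

theorem HasMeanInner.tsum_right {ι : Type*} {b : ι → ℤ →ᵇ E} {v : ι → ℝ} {c : ℤ →ᵇ E}
    (hb : Summable fun i => ‖b i‖) (hc : HasSum b c) (h : ∀ i, HasMeanInner a (b i) (v i)) :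
    HasMeanInner a c (∑' i, v i) := by
  have htsum (N : ℕ) : avgInner N a c = ∑' i, avgInner N a (b i) :=
    (hc.mapL (avgInner N a)).tsum_eq.symm
  simp only [HasMeanInner, htsum]
  exact tendsto_tsum_of_dominated_convergence (hb.mul_left ‖a‖) h
    (Eventually.of_forall fun N i => abs_avgInner_le N a (b i))

theorem hasMeanInner_delay_one_iff :
    HasMeanInner (delay 1 a) (delay 1 b) v ↔ HasMeanInner a b v := by
  have hboundary : Tendsto (fun N : ℕ => (N : ℝ)⁻¹ * (inner ℝ (a 0) (b 0) - inner ℝ (a N) (b N)))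
      atTop (𝓝 0) :=
    tendsto_inv_atTop_nhds_zero_nat.zero_mul_isBoundedUnder_le
      (isBoundedUnder_of ⟨‖a‖ * ‖b‖ + ‖a‖ * ‖b‖, fun N =>
        (norm_sub_le _ _).trans (add_le_add (abs_inner_apply_le a b 0) (abs_inner_apply_le a b N))⟩)
  simp only [HasMeanInner, avgInner_delay_one]
  constructor <;> intro h
  · simpa using h.sub hboundary
  · simpa using h.add hboundary

theorem hasMeanInner_delay_iff (k : ℤ) :
    HasMeanInner (delay k a) (delay k b) v ↔ HasMeanInner a b v := by
  induction k with
  | zero => simp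
  | succ k ih =>
    rw [← ih, add_comm, ← delay_delay, ← delay_delay, hasMeanInner_delay_one_iff]
  | pred k ih =>
    rw [← ih, ← hasMeanInner_delay_one_iff, delay_delay, delay_delay, add_sub_cancel]

variable (E) in
/-- The sequences of zero power, `Ē ‖a(t)‖² = 0`, encoded as those orthogonal to every bounded
sequence. -/
def nullSubmodule : Submodule ℝ (ℤ →ᵇ E) where
  carrier := {a | ∀ b, HasMeanInner b a 0}
  zero_mem' b := by simp [HasMeanInner]
  add_mem' ha hb c := by simpa [HasMeanInner] using (ha c).add (hb c)
  smul_mem' r a ha c := by simpa using (ha c).smul_right r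

theorem mem_nullSubmodule_iff : a ∈ nullSubmodule E ↔ HasMeanInner a a 0 := by
  refine ⟨fun ha => ha a, fun ha b => ?_⟩
  have hbound (N : ℕ) : |avgInner N b a ^ 2| ≤ ‖b‖ * ‖b‖ * avgInner N a a := by
    rw [abs_sq]
    exact (avgInner_sq_le N b a).trans (mul_le_mul_of_nonneg_right
      ((le_abs_self _).trans (abs_avgInner_le N b b)) (avgInner_self_nonneg N a))
  have hsq : Tendsto (fun N => avgInner N b a ^ 2) atTop (𝓝 0) :=
    squeeze_zero_norm hbound (by simpa using ha.const_mul (‖b‖ * ‖b‖))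
  exact (tendsto_zero_iff_abs_tendsto_zero _).2
    (by simpa [Real.sqrt_sq_eq_abs, Function.comp_def] using hsq.sqrt)

theorem delay_mem_nullSubmodule (ha : a ∈ nullSubmodule E) (k : ℤ) :
    delay k a ∈ nullSubmodule E :=
  mem_nullSubmodule_iff.2 ((hasMeanInner_delay_iff k).2 (ha a))

variable [CompleteSpace E]

theorem HasMeanInner.filter_right {f : TF} (hf : f ∈ stableTF) {v : ℕ → ℝ}
    (h : ∀ k : ℕ, HasMeanInner a (PowerSeries.coeff k f • delay k b) (v k)) :
    HasMeanInner a (filterCLM f b) (∑' k, v k) :=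
  HasMeanInner.tsum_right (summable_norm_coeff_smul_delay hf b) (hasSum_filterCLM_apply hf b) h

theorem filterCLM_mem_nullSubmodule {f : TF} (hf : f ∈ stableTF) (ha : a ∈ nullSubmodule E) :
    filterCLM f a ∈ nullSubmodule E := fun b => by
  simpa using HasMeanInner.filter_right hf fun k =>
    (nullSubmodule E).smul_mem (PowerSeries.coeff k f) (delay_mem_nullSubmodule ha k) b

theorem matFilter_mem_nullSubmodule {α β : Type*} [Fintype β] {F : Matrix α β TF}
    (hF : IsStable F) {x : β → ℤ →ᵇ E} (hx : ∀ j, x j ∈ nullSubmodule E) (i : α) :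
    matFilter F x i ∈ nullSubmodule E := by
  rw [matFilter_apply]
  exact sum_mem fun j _ => filterCLM_mem_nullSubmodule (hF i j) (hx j)

theorem hasMeanInner_matFilter_eq_zero {α β : Type*} [Fintype β] {F : Matrix α β TF}
    (hF : IsStable F) {x : β → ℤ →ᵇ E} {i : α}
    (h : ∀ j, ∀ k : ℕ, PowerSeries.coeff k (F i j) = 0 ∨ HasMeanInner a (delay k (x j)) 0) :
    HasMeanInner a (matFilter F x i) 0 := by
  have hterm (j : β) (k : ℕ) :
      HasMeanInner a (PowerSeries.coeff k (F i j) • delay k (x j)) 0 := by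
    rcases h j k with hzero | horth
    · simp [hzero, HasMeanInner]
    · simpa using horth.smul_right (PowerSeries.coeff k (F i j))
  simpa [matFilter_apply] using HasMeanInner.sum_right (s := Finset.univ) fun j _ =>
    HasMeanInner.filter_right (hF i j) (hterm j)

end MeanInner

section Spectrum

/-- The function `φ` is the spectral density of `r : ℤ → ℂ`: it is integrable over a period and
`r(τ) = (1/2π) ∫ e^{iωτ} φ(ω) dω`. -/
structure IsSpectralDensity (r : ℤ → ℂ) (φ : ℝ → ℂ) : Prop where
  intervalIntegrable : IntervalIntegrable φ volume (-Real.pi) Real.pi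
  eq_integral : ∀ τ : ℤ, r τ = (2 * Real.pi : ℂ)⁻¹ *
    ∫ w in (-Real.pi)..Real.pi, Complex.exp (Complex.I * w * τ) * φ w

/-- The frequency response `f(e^{-iω}) = ∑ₖ fₖ e^{iωk}`. With the convention
`r(τ) = Ē ⟪a(t), b(t - τ)⟫` for correlations, filtering `b` by `f` multiplies the spectral density
by this function. -/
noncomputable def freqResponse (f : TF) (w : ℝ) : ℂ :=
  ∑' k : ℕ, ((PowerSeries.coeff k f : ℝ) : ℂ) * Complex.exp (Complex.I * w * (k : ℤ))

theorem norm_exp_I_mul_mul (w : ℝ) (τ : ℤ) : ‖Complex.exp (Complex.I * w * τ)‖ = 1 := by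
  simp [Complex.norm_exp]

theorem exp_I_mul_add (w : ℝ) (σ τ : ℤ) : Complex.exp (Complex.I * w * ((σ + τ : ℤ) : ℂ)) =
    Complex.exp (Complex.I * w * σ) * Complex.exp (Complex.I * w * τ) := by
  rw [← Complex.exp_add, Int.cast_add, mul_add]

theorem intervalIntegrable_exp_mul {φ : ℝ → ℂ} {a b : ℝ} (hφ : IntervalIntegrable φ volume a b)
    (τ : ℤ) : IntervalIntegrable (fun w : ℝ => Complex.exp (Complex.I * w * τ) * φ w) volume a b :=
  hφ.continuousOn_mul (by fun_prop)

theorem integral_exp_int (k : ℤ) :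
    ∫ w in (-Real.pi)..Real.pi, Complex.exp (Complex.I * w * k) =
      if k = 0 then (2 * Real.pi : ℂ) else 0 := by
  split_ifs with hk
  · simp [hk, two_mul]
  · have hI : Complex.I * k ≠ 0 := mul_ne_zero Complex.I_ne_zero (by exact_mod_cast hk)
    have hperiod : Complex.I * k * (Real.pi : ℝ) =
        Complex.I * k * ((-Real.pi : ℝ) : ℂ) + k * (2 * Real.pi * Complex.I) := by
      push_cast
      ring
    have hcomm (w : ℝ) : Complex.I * w * k = Complex.I * k * w := mul_right_comm ..
    simp only [hcomm]
    rw [integral_exp_mul_complex hI, hperiod, Complex.exp_periodic.int_mul k, sub_self, zero_div]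

theorem isSpectralDensity_one : IsSpectralDensity (Pi.single 0 1) fun _ => 1 where
  intervalIntegrable := intervalIntegrable_const
  eq_integral τ := by
    simp only [mul_one, integral_exp_int, Pi.single_apply]
    split_ifs
    · rw [inv_mul_cancel₀ (by simp [Real.pi_ne_zero])]
    · simp

theorem IsSpectralDensity.conj {r : ℤ → ℂ} {φ : ℝ → ℂ} (h : IsSpectralDensity r φ) :
    IsSpectralDensity (fun τ => star (r (-τ))) fun w => star (φ w) where
  intervalIntegrable :=
    ⟨Complex.conjCLE.toContinuousLinearMap.integrable_comp h.intervalIntegrable.1,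
      Complex.conjCLE.toContinuousLinearMap.integrable_comp h.intervalIntegrable.2⟩
  eq_integral τ := by
    have hpi : -Real.pi ≤ Real.pi := neg_le_self Real.pi_nonneg
    have hconj (w : ℝ) : star (Complex.exp (Complex.I * w * ((-τ : ℤ) : ℂ)) * φ w) =
        Complex.exp (Complex.I * w * τ) * star (φ w) := by
      simp [← Complex.exp_conj]
    simp only [← hconj, h.eq_integral, intervalIntegral.integral_of_le hpi, star_mul']
    simp [← integral_conj]

theorem IsSpectralDensity.sum {ι : Type*} {s : Finset ι} {r : ι → ℤ → ℂ} {φ : ι → ℝ → ℂ}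
    (h : ∀ i ∈ s, IsSpectralDensity (r i) (φ i)) :
    IsSpectralDensity (fun τ => ∑ i ∈ s, r i τ) fun w => ∑ i ∈ s, φ i w where
  intervalIntegrable := by
    simpa only [Finset.sum_fn] using
      IntervalIntegrable.sum s fun i hi => (h i hi).intervalIntegrable
  eq_integral τ := by
    simp only [Finset.mul_sum]
    rw [intervalIntegral.integral_finsetSum fun i hi =>
      intervalIntegrable_exp_mul (h i hi).intervalIntegrable τ, Finset.mul_sum]
    exact Finset.sum_congr rfl fun i hi => (h i hi).eq_integral τ

theorem continuous_freqResponse {f : TF} (hf : f ∈ stableTF) : Continuous (freqResponse f) :=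
  continuous_tsum (fun k => by fun_prop) hf fun k w => by
    simp only [norm_mul, norm_exp_I_mul_mul, mul_one, Complex.norm_real, Real.norm_eq_abs, le_refl]

theorem integral_freqResponse_mul {f : TF} (hf : f ∈ stableTF) {φ : ℝ → ℂ} {a b : ℝ} (hab : a ≤ b)
    (hφ : IntervalIntegrable φ volume a b) :
    ∫ w in a..b, freqResponse f w * φ w =
      ∑' k : ℕ, ((PowerSeries.coeff k f : ℝ) : ℂ) *
        ∫ w in a..b, Complex.exp (Complex.I * w * (k : ℤ)) * φ w := by
  have hterm (k : ℕ) : IntervalIntegrable (fun w : ℝ => ((PowerSeries.coeff k f : ℝ) : ℂ) *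
      (Complex.exp (Complex.I * w * (k : ℤ)) * φ w)) volume a b :=
    (intervalIntegrable_exp_mul hφ k).const_mul _
  have hnorm (k : ℕ) (w : ℝ) : ‖((PowerSeries.coeff k f : ℝ) : ℂ) *
      (Complex.exp (Complex.I * w * (k : ℤ)) * φ w)‖ = |PowerSeries.coeff k f| * ‖φ w‖ := by
    rw [norm_mul, norm_mul, norm_exp_I_mul_mul, one_mul, Complex.norm_real, Real.norm_eq_abs]
  simp only [← intervalIntegral.integral_const_mul]
  simp only [intervalIntegral.integral_of_le hab]
  rw [integral_tsum_of_summable_integral_norm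
    fun k => (intervalIntegrable_iff_integrableOn_Ioc_of_le hab).1 (hterm k)]
  · simp only [freqResponse, ← tsum_mul_right, mul_assoc]
  · simp only [hnorm, integral_const_mul]
    exact hf.mul_right _

theorem IsSpectralDensity.freqResponse_mul {r : ℤ → ℂ} {φ : ℝ → ℂ} (h : IsSpectralDensity r φ)
    {f : TF} (hf : f ∈ stableTF) :
    IsSpectralDensity (fun τ => ∑' k : ℕ, ((PowerSeries.coeff k f : ℝ) : ℂ) * r (k + τ))
      fun w => freqResponse f w * φ w where
  intervalIntegrable :=
    h.intervalIntegrable.continuousOn_mul (continuous_freqResponse hf).continuousOn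
  eq_integral τ := by
    simp only [mul_left_comm _ (freqResponse f _)]
    rw [integral_freqResponse_mul hf (neg_le_self Real.pi_nonneg)
      (intervalIntegrable_exp_mul h.intervalIntegrable τ), ← tsum_mul_left]
    simp only [h.eq_integral, exp_I_mul_add, mul_assoc (Complex.exp _),
      mul_left_comm _ (2 * Real.pi : ℂ)⁻¹]

-- Filtering white noise, of spectral density `1`, by `f` gives the density `freqResponse f`, whose
-- Fourier coefficients are therefore those of `f`.
theorem eq_zero_of_freqResponse_ae_eq_zero {f : TF} (hf : f ∈ stableTF)
    (h : ∀ᵐ w ∂volume.restrict (Set.Ioc (-Real.pi) Real.pi), freqResponse f w = 0) : f = 0 := by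
  ext n
  have hcoeff := (isSpectralDensity_one.freqResponse_mul hf).eq_integral (-n)
  rw [tsum_eq_single n fun k hk => by simp [← sub_eq_add_neg, sub_eq_zero, hk],
    intervalIntegral.integral_of_le (neg_le_self Real.pi_nonneg), integral_eq_zero_of_ae
      (h.mono fun w hw => by simp [hw])] at hcoeff
  simpa using hcoeff

end Spectrum

section Correlation

variable {E : Type*} [NormedAddCommGroup E] [InnerProductSpace ℝ E] {a b : ℤ →ᵇ E}

/-- The cross-correlation function of `a` and `b` is `r(τ) = Ē ⟪a(t), b(t - τ)⟫`. -/
def HasCorrelation (a b : ℤ →ᵇ E) (r : ℤ → ℝ) : Prop :=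
  ∀ τ, HasMeanInner a (delay τ b) (r τ)

theorem HasCorrelation.hasMeanInner {r : ℤ → ℝ} (h : HasCorrelation a b r) :
    HasMeanInner a b (r 0) := by
  simpa using h 0

theorem HasCorrelation.symm {r : ℤ → ℝ} (h : HasCorrelation a b r) :
    HasCorrelation b a fun τ => r (-τ) := fun τ => by
  simpa [delay_delay] using ((hasMeanInner_delay_iff τ).2 (h (-τ))).symm

theorem HasCorrelation.sum_right {ι : Type*} {s : Finset ι} {b : ι → ℤ →ᵇ E} {r : ι → ℤ → ℝ}
    (h : ∀ i ∈ s, HasCorrelation a (b i) (r i)) :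
    HasCorrelation a (∑ i ∈ s, b i) fun τ => ∑ i ∈ s, r i τ := fun τ => by
  simpa using HasMeanInner.sum_right fun i hi => h i hi τ

/-- The correlation function of `a` and `b` has spectral density `φ`. -/
def HasCrossSpectrum (a b : ℤ →ᵇ E) (φ : ℝ → ℂ) : Prop :=
  ∃ r : ℤ → ℝ, HasCorrelation a b r ∧ IsSpectralDensity (fun τ => (r τ : ℂ)) φ

theorem HasCrossSpectrum.symm {φ : ℝ → ℂ} (h : HasCrossSpectrum a b φ) :
    HasCrossSpectrum b a fun w => star (φ w) := by
  obtain ⟨r, hr, hφ⟩ := h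
  exact ⟨_, hr.symm, by simpa using hφ.conj⟩

theorem HasCrossSpectrum.sum_right {ι : Type*} {s : Finset ι} {b : ι → ℤ →ᵇ E} {φ : ι → ℝ → ℂ}
    (h : ∀ i ∈ s, HasCrossSpectrum a (b i) (φ i)) :
    HasCrossSpectrum a (∑ i ∈ s, b i) fun w => ∑ i ∈ s, φ i w := by
  choose! r hr hφ using h
  exact ⟨_, HasCorrelation.sum_right hr, by simpa using IsSpectralDensity.sum hφ⟩

theorem ae_eq_zero_of_mem_nullSubmodule {φ : ℝ → ℂ} (hφ : HasCrossSpectrum a a φ)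
    (ha : a ∈ nullSubmodule E)
    (hnonneg : ∀ᵐ w ∂volume.restrict (Set.Ioc (-Real.pi) Real.pi), 0 ≤ φ w) :
    ∀ᵐ w ∂volume.restrict (Set.Ioc (-Real.pi) Real.pi), φ w = 0 := by
  have hpi : -Real.pi ≤ Real.pi := neg_le_self Real.pi_nonneg
  obtain ⟨r, hr, hint, hfourier⟩ := hφ
  rw [intervalIntegrable_iff_integrableOn_Ioc_of_le hpi] at hint
  have hpower : ∫ w in Set.Ioc (-Real.pi) Real.pi, φ w = 0 := by
    simpa [tendsto_nhds_unique hr.hasMeanInner (ha a), Real.pi_ne_zero,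
      intervalIntegral.integral_of_le hpi] using hfourier 0
  have hre : ∫ w in Set.Ioc (-Real.pi) Real.pi, (φ w).re = 0 := by
    simpa [hpower] using integral_re (𝕜 := ℂ) hint
  have hae := (integral_eq_zero_iff_of_nonneg_ae
    (hnonneg.mono fun w hw => (Complex.le_def.1 hw).1) hint.re).1 hre
  filter_upwards [hnonneg, hae] with w hw hw0
  exact Complex.ext hw0 (Complex.le_def.1 hw).2.symm

variable [CompleteSpace E] {f : TF}

theorem HasCorrelation.filter_right {r : ℤ → ℝ} (h : HasCorrelation a b r) (hf : f ∈ stableTF) :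
    HasCorrelation a (filterCLM f b) fun τ => ∑' k : ℕ, PowerSeries.coeff k f * r (k + τ) :=
  fun τ => by
    rw [delay_filterCLM hf]
    refine HasMeanInner.filter_right hf fun k => ?_
    simpa [delay_delay] using (h (k + τ)).smul_right (PowerSeries.coeff k f)

theorem HasCrossSpectrum.filter_right {φ : ℝ → ℂ} (h : HasCrossSpectrum a b φ)
    (hf : f ∈ stableTF) :
    HasCrossSpectrum a (filterCLM f b) fun w => freqResponse f w * φ w := by
  obtain ⟨r, hr, hφ⟩ := h
  exact ⟨_, hr.filter_right hf, by simpa [Complex.ofReal_tsum] using hφ.freqResponse_mul hf⟩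

variable {α β : Type*} [Fintype β] {F : Matrix α β TF} {x : β → ℤ →ᵇ E}

theorem exists_hasCorrelation_matFilter_right (hF : IsStable F)
    (h : ∀ j, ∃ r, HasCorrelation a (x j) r) (i : α) :
    ∃ r, HasCorrelation a (matFilter F x i) r := by
  choose r hr using h
  rw [matFilter_apply]
  exact ⟨_, HasCorrelation.sum_right fun j _ => (hr j).filter_right (hF i j)⟩

theorem exists_hasMeanInner_matFilter (hF : IsStable F)
    (h : ∀ i j, ∃ r, HasCorrelation (x i) (x j) r) (i j : α) :
    ∃ v, HasMeanInner (matFilter F x i) (matFilter F x j) v := by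
  have hleft (l : β) : ∃ r, HasCorrelation (matFilter F x i) (x l) r := by
    obtain ⟨r, hr⟩ := exists_hasCorrelation_matFilter_right hF (h l) i
    exact ⟨_, hr.symm⟩
  obtain ⟨r, hr⟩ := exists_hasCorrelation_matFilter_right hF hleft j
  exact ⟨_, hr.hasMeanInner⟩

theorem hasCrossSpectrum_sum_filterCLM {Φ : ℝ → Matrix β β ℂ}
    (hΦ : ∀ i j, HasCrossSpectrum (x i) (x j) fun w => Φ w i j) {d : β → TF}
    (hd : ∀ j, d j ∈ stableTF) :
    HasCrossSpectrum (∑ j, filterCLM (d j) (x j)) (∑ j, filterCLM (d j) (x j)) fun w =>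
      star (fun j => freqResponse (d j) w) ⬝ᵥ Φ w *ᵥ fun j => freqResponse (d j) w := by
  have hleft (i : β) : HasCrossSpectrum (∑ j, filterCLM (d j) (x j)) (x i)
      fun w => star (∑ j, freqResponse (d j) w * Φ w i j) :=
    (HasCrossSpectrum.sum_right fun j _ => (hΦ i j).filter_right (hd j)).symm
  convert (HasCrossSpectrum.sum_right (s := Finset.univ) fun i _ =>
    (hleft i).filter_right (hd i)).symm using 2 with w
  simp only [dotProduct, Matrix.mulVec, star_sum, star_mul', Pi.star_apply, star_star, mul_comm]

theorem eq_zero_of_sum_filterCLM_mem_nullSubmodule {Φ : ℝ → Matrix β β ℂ}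
    (hΦ : ∀ i j, HasCrossSpectrum (x i) (x j) fun w => Φ w i j) (hpos : PosDefAE Φ) {d : β → TF}
    (hd : ∀ j, d j ∈ stableTF) (hnull : ∑ j, filterCLM (d j) (x j) ∈ nullSubmodule E) :
    d = 0 := by
  have hquad := ae_eq_zero_of_mem_nullSubmodule (hasCrossSpectrum_sum_filterCLM hΦ hd) hnull
    (hpos.mono fun w hw => hw.posSemidef.dotProduct_mulVec_nonneg _)
  funext j
  refine eq_zero_of_freqResponse_ae_eq_zero (hd j) ?_
  filter_upwards [hpos, hquad] with w hw hzero
  by_contra hne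
  exact (hw.dotProduct_mulVec_pos (x := fun j => freqResponse (d j) w)
    fun h => hne (congrFun h j)).ne' hzero

end Correlation

section QuadraticForm

variable {E : Type*} [NormedAddCommGroup E] [InnerProductSpace ℝ E] {ι : Type*} [Fintype ι]
  {Q : Matrix ι ι ℝ} {x w : ι → ℤ →ᵇ E} {v v' : ℝ}

/-- The time average of the quadratic form `x(t)ᵀ Q x(t)`, where products of components are inner
products in `E`. -/
noncomputable def avgForm (Q : Matrix ι ι ℝ) (N : ℕ) (x : ι → ℤ →ᵇ E) : ℝ :=
  ∑ i, ∑ j, Q i j * avgInner N (x i) (x j)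

/-- `Ē x(t)ᵀ Q x(t) = v`: the weighted mean power of `x` is `v`. -/
def HasMeanForm (Q : Matrix ι ι ℝ) (x : ι → ℤ →ᵇ E) (v : ℝ) : Prop :=
  Tendsto (fun N => avgForm Q N x) atTop (𝓝 v)

theorem exists_hasMeanForm (Q : Matrix ι ι ℝ) (h : ∀ i j, ∃ v, HasMeanInner (x i) (x j) v) :
    ∃ v, HasMeanForm Q x v := by
  choose v hv using h
  exact ⟨_, tendsto_finsetSum _ fun i _ => tendsto_finsetSum _ fun j _ =>
    (hv i j).const_mul (Q i j)⟩

theorem HasMeanForm.add_of_orthogonal (hx : HasMeanForm Q x v) (hw : HasMeanForm Q w v')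
    (horth : ∀ i j, HasMeanInner (x i) (w j) 0) : HasMeanForm Q (x + w) (v + v') := by
  have hcross : Tendsto (fun N => ∑ i, ∑ j, Q i j *
      (avgInner N (x i) (w j) + avgInner N (w i) (x j))) atTop (𝓝 0) := by
    simpa using tendsto_finsetSum _ fun i (_ : i ∈ Finset.univ) =>
      tendsto_finsetSum _ fun j (_ : j ∈ Finset.univ) =>
        ((horth i j).add (horth j i).symm).const_mul (Q i j)
  have hexpand (N : ℕ) : avgForm Q N (x + w) = avgForm Q N x + avgForm Q N w +
      ∑ i, ∑ j, Q i j * (avgInner N (x i) (w j) + avgInner N (w i) (x j)) := by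
    simp only [avgForm, ← Finset.sum_add_distrib, ← mul_add, Pi.add_apply, map_add, add_apply]
    exact Finset.sum_congr rfl fun i _ => Finset.sum_congr rfl fun j _ => by ring
  simpa only [HasMeanForm, hexpand, add_zero] using (hx.add hw).add hcross

theorem avgForm_star_mul_self (B : Matrix ι ι ℝ) (N : ℕ) (x : ι → ℤ →ᵇ E) :
    avgForm (star B * B) N x = ∑ k, avgInner N (∑ i, B k i • x i) (∑ i, B k i • x i) := by
  simp only [avgForm, Matrix.mul_apply, Matrix.star_apply, star_trivial, map_sum, sum_apply,
    map_smul, smul_apply, smul_eq_mul, Finset.sum_mul, Finset.mul_sum, ← mul_assoc]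
  rw [Finset.sum_comm_cycle]
  exact Finset.sum_congr rfl fun k _ => Finset.sum_congr rfl fun i _ =>
    Finset.sum_congr rfl fun j _ => by rw [avgInner_comm]

open scoped MatrixOrder Matrix.Norms.L2Operator in
theorem avgForm_nonneg (hQ : Q.PosSemidef) (N : ℕ) (x : ι → ℤ →ᵇ E) : 0 ≤ avgForm Q N x := by
  classical
  obtain ⟨B, rfl⟩ := CStarAlgebra.nonneg_iff_eq_star_mul_self.1 hQ.nonneg
  rw [avgForm_star_mul_self]
  exact Finset.sum_nonneg fun k _ => avgInner_self_nonneg N _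

theorem HasMeanForm.nonneg (hQ : Q.PosSemidef) (h : HasMeanForm Q x v) : 0 ≤ v :=
  ge_of_tendsto' h fun N => avgForm_nonneg hQ N x

open scoped MatrixOrder Matrix.Norms.L2Operator in
theorem HasMeanForm.mem_nullSubmodule (hQ : Q.PosDef) (h : HasMeanForm Q x 0) (i : ι) :
    x i ∈ nullSubmodule E := by
  classical
  obtain ⟨B, hB, rfl⟩ :=
    CStarAlgebra.isStrictlyPositive_iff_eq_star_mul_self.1 hQ.isStrictlyPositive
  simp only [HasMeanForm, avgForm_star_mul_self] at h
  have hBx (k : ι) : ∑ j, B k j • x j ∈ nullSubmodule E :=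
    mem_nullSubmodule_iff.2 <| squeeze_zero (fun N => avgInner_self_nonneg N _)
      (fun N => Finset.single_le_sum (f := fun k => avgInner N (∑ j, B k j • x j) _)
        (fun k _ => avgInner_self_nonneg N _) (Finset.mem_univ k)) h
  have hinv : x i = ∑ k, B⁻¹ i k • ∑ j, B k j • x j := by
    simp only [Finset.smul_sum, smul_smul]
    rw [Finset.sum_comm]
    simp only [← Finset.sum_smul, ← Matrix.mul_apply,
      Matrix.nonsing_inv_mul B ((Matrix.isUnit_iff_isUnit_det B).1 hB), Matrix.one_apply, ite_smul,
      one_smul, zero_smul, Finset.sum_ite_eq, Finset.mem_univ, if_true]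
  rw [hinv]
  exact sum_mem fun k _ => Submodule.smul_mem _ _ (hBx k)

theorem HasMeanForm.eq_zero_iff (hQ : Q.PosDef) (h : HasMeanForm Q x v) :
    v = 0 ↔ ∀ i, x i ∈ nullSubmodule E := by
  refine ⟨?_, fun hnull => ?_⟩
  · rintro rfl
    exact h.mem_nullSubmodule hQ
  · have hzero : HasMeanForm Q x 0 := by
      simpa [HasMeanForm, avgForm] using tendsto_finsetSum _ fun i (_ : i ∈ Finset.univ) =>
        tendsto_finsetSum _ fun j (_ : j ∈ Finset.univ) => (hnull j (x i)).const_mul (Q i j)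
    exact tendsto_nhds_unique h hzero

end QuadraticForm

section Represents

variable {Ω : Type*} [MeasurableSpace Ω] {P : Measure Ω} {α β : Type*}
  {s : Signal Ω α} {s' : Signal Ω β} {X : α → ℤ →ᵇ Lp ℝ 2 P} {Y : β → ℤ →ᵇ Lp ℝ 2 P}

/-- The components of the signal `s` agree almost surely with the bounded sequences `X` in `L²`.
Passing to `L²` turns expectations of products into inner products. -/
def Represents (P : Measure Ω) (s : Signal Ω α) (X : α → ℤ →ᵇ Lp ℝ 2 P) : Prop :=
  ∀ t i, ∀ᵐ ω ∂P, s t ω i = X i t ω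

theorem Represents.filt [Fintype α] {F : Matrix β α TF} (hF : IsStable F)
    (hs : Represents P s X) : Represents P (filt F s) (matFilter F X) := by
  intro t i
  have hterm (j : α) : ∀ᵐ ω ∂P,
      ∑' k : ℕ, PowerSeries.coeff k (F i j) * s (t - k) ω j = filterCLM (F i j) (X j) t ω := by
    have hsum : ∑' k : ℕ, ‖PowerSeries.coeff k (F i j) • X j (t - k)‖ₑ ≠ ⊤ :=
      tsum_enorm_ne_top_iff_summable_norm.2 <|
        (summable_norm_coeff_smul_delay (hF i j) (X j)).of_nonneg_of_le (fun _ => norm_nonneg _)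
          fun k => (PowerSeries.coeff k (F i j) • delay k (X j)).norm_coe_le_norm t
    filter_upwards [Lp.hasSum_coeFn_tsum hsum, ae_all_iff.2 fun k : ℕ => hs (t - k) j,
      ae_all_iff.2 fun k : ℕ => Lp.coeFn_smul (PowerSeries.coeff k (F i j)) (X j (t - k))]
      with ω htsum hrep hsmul
    rw [filterCLM_apply_apply (hF i j), ← htsum.tsum_eq]
    refine tsum_congr fun k => ?_
    rw [hrep k, hsmul k, Pi.smul_apply, smul_eq_mul]
  filter_upwards [ae_all_iff.2 hterm,
    Lp.coeFn_fun_finsetSum Finset.univ fun j => filterCLM (F i j) (X j) t] with ω hω hsum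
  rw [matFilter_apply, BoundedContinuousFunction.sum_apply, hsum]
  exact Finset.sum_congr rfl fun j _ => hω j

theorem Represents.sub {s' : Signal Ω α} {Y : α → ℤ →ᵇ Lp ℝ 2 P} (hs : Represents P s X)
    (hs' : Represents P s' Y) : Represents P (fun t ω => s t ω - s' t ω) (X - Y) := by
  intro t i
  filter_upwards [hs t i, hs' t i, Lp.coeFn_sub (X i t) (Y i t)] with ω h h' hsub
  exact (congrArg₂ (· - ·) h h').trans hsub.symm

theorem Represents.mul_ae_eq (hs : Represents P s X) (hs' : Represents P s' Y) (t t' : ℤ)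
    (i : α) (j : β) :
    (fun ω => inner ℝ (X i t ω) (Y j t' ω)) =ᵐ[P] fun ω => s t ω i * s' t' ω j := by
  filter_upwards [hs t i, hs' t' j] with ω h h'
  rw [h, h', real_inner_comm]
  rfl

theorem Represents.integrable_mul (hs : Represents P s X) (hs' : Represents P s' Y) (t t' : ℤ)
    (i : α) (j : β) : Integrable (fun ω => s t ω i * s' t' ω j) P :=
  (L2.integrable_inner (𝕜 := ℝ) (X i t) (Y j t')).congr (hs.mul_ae_eq hs' t t' i j)

theorem Represents.integral_mul (hs : Represents P s X) (hs' : Represents P s' Y) (t t' : ℤ)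
    (i : α) (j : β) : ∫ ω, s t ω i * s' t' ω j ∂P = inner ℝ (X i t) (Y j t') := by
  rw [L2.inner_def]
  exact (integral_congr_ae (hs.mul_ae_eq hs' t t' i j)).symm

theorem HasGenExp.hasMeanInner (hs : Represents P s X) (hs' : Represents P s' Y) {τ : ℤ}
    {i : α} {j : β} {v : ℝ} (h : HasGenExp P (fun t ω => s t ω i * s' (t - τ) ω j) v) :
    HasMeanInner (X i) (delay τ (Y j)) v := by
  simpa only [hs.integral_mul hs', HasMeanInner, avgInner_apply, delay_apply] using h.2

theorem Represents.hasGenExp_form [Fintype α] (hs : Represents P s X) {Q : Matrix α α ℝ} {v : ℝ}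
    (h : HasMeanForm Q X v) : HasGenExp P (fun t ω => s t ω ⬝ᵥ Q *ᵥ s t ω) v := by
  have hform (t : ℤ) (ω : Ω) :
      s t ω ⬝ᵥ Q *ᵥ s t ω = ∑ i, ∑ j, Q i j * (s t ω i * s t ω j) := by
    simp only [dotProduct, Matrix.mulVec, Finset.mul_sum, mul_left_comm]
  have hint (t : ℤ) (i j : α) : Integrable (fun ω => Q i j * (s t ω i * s t ω j)) P :=
    (hs.integrable_mul hs t t i j).const_mul _
  have hint_row (t : ℤ) (i : α) : Integrable (fun ω => ∑ j, Q i j * (s t ω i * s t ω j)) P :=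
    integrable_finsetSum _ fun j _ => hint t i j
  have hintegral (t : ℤ) : ∫ ω, s t ω ⬝ᵥ Q *ᵥ s t ω ∂P =
      ∑ i, ∑ j, Q i j * inner ℝ (X i t) (X j t) := by
    simp only [hform, integral_finsetSum _ fun i _ => hint_row t i,
      integral_finsetSum _ fun j _ => hint t _ j, integral_const_mul, hs.integral_mul hs]
  have havg (N : ℕ) : (N : ℝ)⁻¹ * ∑ t ∈ Finset.Icc (1 : ℤ) N, ∫ ω, s t ω ⬝ᵥ Q *ᵥ s t ω ∂P =
      avgForm Q N X := by
    simp only [hintegral, avgForm, avgInner_apply, Finset.mul_sum, mul_left_comm (N : ℝ)⁻¹]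
    rw [Finset.sum_comm]
    exact Finset.sum_congr rfl fun i _ => Finset.sum_comm
  refine ⟨fun t => ?_, by simpa only [havg, HasMeanForm] using h⟩
  simpa only [hform] using integrable_finsetSum _ fun i _ => hint_row t i

theorem IsQuasiStationary.exists_represents (h : IsQuasiStationary P s) :
    ∃ X : α → ℤ →ᵇ Lp ℝ 2 P, Represents P s X := by
  obtain ⟨C, hC⟩ := h.bounded
  have hnorm (i : α) (t : ℤ) : ‖(h.memLp t i).toLp‖ ≤ √C := by
    refine Real.le_sqrt_of_sq_le ?_
    rw [← real_inner_self_eq_norm_sq, L2.inner_def]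
    refine le_of_eq_of_le (integral_congr_ae ?_) (hC t i)
    filter_upwards [(h.memLp t i).coeFn_toLp] with ω hω
    rw [hω, real_inner_self_eq_norm_sq, Real.norm_eq_abs, sq_abs]
  exact ⟨fun i => .ofNormedAddCommGroupDiscrete (fun t => (h.memLp t i).toLp) (√C) (hnorm i),
    fun t i => (h.memLp t i).coeFn_toLp.symm⟩

theorem IsCorrelation.hasCorrelation {R : ℤ → Matrix α α ℝ} (hR : IsCorrelation P s R)
    (hs : Represents P s X) (i j : α) : HasCorrelation (X i) (X j) fun τ => R τ i j :=
  fun τ => (hR τ i j).hasMeanInner hs hs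

theorem IsSpectrum.hasCrossSpectrum {Φ : ℝ → Matrix α α ℂ} (hΦ : IsSpectrum P s Φ)
    (hs : Represents P s X) (i j : α) : HasCrossSpectrum (X i) (X j) fun w => Φ w i j := by
  obtain ⟨hint, R, hR, hfourier⟩ := hΦ
  exact ⟨_, hR.hasCorrelation hs i j, hint i j, fun τ => hfourier τ i j⟩

theorem eq_zero_of_mem_nullSubmodule_of_support [Fintype α] (hs : Represents P s X) {S : Set α}
    {Φ : ℝ → Matrix S S ℂ} (hΦ : IsSpectrum P (subSignal s S) Φ) (hpos : PosDefAE Φ) {d : α → TF}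
    (hd : ∀ j, d j ∈ stableTF) (hS : ∀ j ∉ S, d j = 0)
    (hnull : ∑ j, filterCLM (d j) (X j) ∈ nullSubmodule (Lp ℝ 2 P)) : d = 0 := by
  classical
  have hrep : Represents P (subSignal s S) fun j : S => X j := fun t j => hs t j
  have hsum : ∑ j, filterCLM (d j) (X j) = ∑ j : S, filterCLM (d j) (X j) := by
    rw [← Finset.sum_filter_of_ne (p := (· ∈ S)), Finset.sum_subtype (p := (· ∈ S)) _ (by simp)]
    exact fun j _ hne => by_contra fun hj => hne (by simp [hS j hj])
  rw [hsum] at hnull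
  have hzero : (fun j : S => d j) = 0 := eq_zero_of_sum_filterCLM_mem_nullSubmodule
    (hΦ.hasCrossSpectrum hrep) hpos (fun j => hd j) hnull
  funext j
  by_cases hj : j ∈ S
  · exact congrFun hzero ⟨j, hj⟩
  · exact hS j hj

end Represents

theorem filt_fromCols_stack {Ω α β ι : Type*} [Fintype α] [Fintype β] (F : Matrix ι α TF)
    (F' : Matrix ι β TF) (s : Signal Ω α) (s' : Signal Ω β) (t : ℤ) (ω : Ω) :
    filt (Matrix.fromCols F F') (stack s s') t ω = filt F s t ω + filt F' s' t ω := by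
  funext i
  simp [filt, stack, Fintype.sum_sum_type]

section PredictionError

variable {Ω : Type*} [MeasurableSpace Ω] {P : Measure Ω} {p m : ℕ}
  {G0 G : Matrix (Fin p) (Fin m) TF} {H0 H : Matrix (Fin p) (Fin p) TF}

theorem IsAdmissible.isUnit_det (h : IsAdmissible G H) : IsUnit H.det := by
  rw [PowerSeries.isUnit_iff_constantCoeff, RingHom.map_det, RingHom.mapMatrix_apply, h.monic_H]
  simp

theorem IsAdmissible.isStable_combined (h : IsAdmissible G H) : IsStable (combined G H) :=
  h.stable_G.fromCols h.stable_H

/-- The filter `H⁻¹ (M⁰ - M)` that produces the difference between the prediction error of the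
model `M = [G H]` and the noise from the signal `κ = (u, e)`, when the system is `M⁰ = [G⁰ H⁰]`. -/
noncomputable def mismatch (G0 G : Matrix (Fin p) (Fin m) TF) (H0 H : Matrix (Fin p) (Fin p) TF) :
    Matrix (Fin p) (Fin m ⊕ Fin p) TF :=
  H⁻¹ * (combined G0 H0 - combined G H)

theorem isStable_mismatch (h0 : IsAdmissible G0 H0) (h : IsAdmissible G H) :
    IsStable (mismatch G0 G H0 H) :=
  h.stable_H_inv.mul (h0.isStable_combined.sub h.isStable_combined)

theorem mul_mismatch (h : IsAdmissible G H) :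
    H * mismatch G0 G H0 H = combined G0 H0 - combined G H := by
  rw [mismatch, ← Matrix.mul_assoc, Matrix.mul_nonsing_inv _ h.isUnit_det, Matrix.one_mul]

theorem coeff_zero_mismatch_inr (h0 : IsAdmissible G0 H0) (h : IsAdmissible G H) (i j : Fin p) :
    PowerSeries.coeff 0 (mismatch G0 G H0 H i (Sum.inr j)) = 0 := by
  have hmonic (l : Fin p) :
      PowerSeries.constantCoeff (H0 l j) = PowerSeries.constantCoeff (H l j) :=
    congrFun (congrFun (h0.monic_H.trans h.monic_H.symm) l) j
  simp [mismatch, Matrix.mul_apply, hmonic]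

theorem matFilter_mismatch {E : Type*} [NormedAddCommGroup E] [NormedSpace ℝ E] [CompleteSpace E]
    (h0 : IsAdmissible G0 H0) (h : IsAdmissible G H) (x : Fin m ⊕ Fin p → ℤ →ᵇ E) :
    matFilter (mismatch G0 G H0 H) x = matFilter H⁻¹ (matFilter (combined G0 H0) x) -
      matFilter (H⁻¹ * G) (x ∘ Sum.inl) - x ∘ Sum.inr := by
  rw [mismatch, matFilter_mul h.stable_H_inv (h0.isStable_combined.sub h.isStable_combined),
    matFilter_sub h0.isStable_combined h.isStable_combined, matFilter_fromCols G H, map_sub,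
    map_add, ← matFilter_mul h.stable_H_inv h.stable_G, ← matFilter_mul h.stable_H_inv h.stable_H,
    Matrix.nonsing_inv_mul _ h.isUnit_det, matFilter_one, sub_sub]

variable {u : Signal Ω (Fin m)} {e y : Signal Ω (Fin p)} {K : Fin m ⊕ Fin p → ℤ →ᵇ Lp ℝ 2 P}

theorem represents_predictionError (hK : Represents P (stack u e) K) (h0 : IsAdmissible G0 H0)
    (h : IsAdmissible G H) (hy : ∀ t, ∀ᵐ ω ∂P, y t ω = filt G0 u t ω + filt H0 e t ω) :
    Represents P (predictionError G H y u)
      (K ∘ Sum.inr + matFilter (mismatch G0 G H0 H) K) := by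
  set Y := matFilter (combined G0 H0) K
  have hY : Represents P y Y := fun t i => by
    filter_upwards [hy t, hK.filt h0.isStable_combined t i] with ω hω hfilt
    rw [hω, ← hfilt, combined, filt_fromCols_stack]
  have hdata : Represents P (stack y u) (Sum.elim Y (K ∘ Sum.inl))
    | t, .inl i => hY t i
    | t, .inr j => hK t (Sum.inl j)
  have hpredictor : IsStable (predictorFilter G H) :=
    (isStable_one.sub h.stable_H_inv).fromCols (h.stable_H_inv.mul h.stable_G)
  have herror : K ∘ Sum.inr + matFilter (mismatch G0 G H0 H) K =
      Y - matFilter (predictorFilter G H) (Sum.elim Y (K ∘ Sum.inl)) := by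
    rw [matFilter_mismatch h0 h, predictorFilter, matFilter_fromCols (1 - H⁻¹), Sum.elim_comp_inl,
      Sum.elim_comp_inr, matFilter_sub isStable_one h.stable_H_inv, matFilter_one]
    abel
  rw [herror]
  exact hY.sub (hdata.filt hpredictor)

theorem hasMeanInner_noise_mismatch (hK : Represents P (stack u e) K) (h0 : IsAdmissible G0 H0)
    (h : IsAdmissible G H) (hwhite : IsWhite P e) (hue : IsUncorrelatedWithPast P e u)
    (i j : Fin p) :
    HasMeanInner (K (Sum.inr i)) (matFilter (mismatch G0 G H0 H) K j) 0 := by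
  have hu : Represents P u (K ∘ Sum.inl) := fun t j => hK t (Sum.inl j)
  have he : Represents P e (K ∘ Sum.inr) := fun t j => hK t (Sum.inr j)
  refine hasMeanInner_matFilter_eq_zero (isStable_mismatch h0 h) fun l k => ?_
  rcases l with l | l
  · exact .inr ((hue k k.cast_nonneg i l).hasMeanInner he hu)
  rcases eq_or_ne k 0 with rfl | hk
  · exact .inl (coeff_zero_mismatch_inr h0 h j l)
  · exact .inr ((hwhite k (Nat.cast_ne_zero.2 hk) i l).hasMeanInner he he)

theorem exists_hasGenExp_predictionError {Q : Matrix (Fin p) (Fin p) ℝ} (hQ : Q.PosDef)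
    (hK : Represents P (stack u e) K) (hcorr : ∀ i j, ∃ r, HasCorrelation (K i) (K j) r)
    (h0 : IsAdmissible G0 H0) (h : IsAdmissible G H)
    (hwhite : IsWhite P e) (hue : IsUncorrelatedWithPast P e u)
    (hy : ∀ t, ∀ᵐ ω ∂P, y t ω = filt G0 u t ω + filt H0 e t ω) {c : ℝ}
    (hc : HasMeanForm Q (K ∘ Sum.inr) c) :
    ∃ v, HasGenExp P
        (fun t ω => predictionError G H y u t ω ⬝ᵥ Q *ᵥ predictionError G H y u t ω) v ∧
      c ≤ v ∧ (v = c ↔ ∀ i, matFilter (mismatch G0 G H0 H) K i ∈ nullSubmodule (Lp ℝ 2 P)) := by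
  obtain ⟨q, hq⟩ :=
    exists_hasMeanForm Q (exists_hasMeanInner_matFilter (isStable_mismatch h0 h) hcorr)
  have hcost := hc.add_of_orthogonal hq (hasMeanInner_noise_mismatch hK h0 h hwhite hue)
  refine ⟨c + q, (represents_predictionError hK h0 h hy).hasGenExp_form hcost,
    le_add_of_nonneg_right (hq.nonneg hQ.posSemidef), ?_⟩
  rw [add_eq_left]
  exact hq.eq_zero_iff hQ

theorem combined_eq_of_mismatch_mem_nullSubmodule (hK : Represents P (stack u e) K)
    (h0 : IsAdmissible G0 H0) (h : IsAdmissible G H) {S : Fin p → Set (Fin m ⊕ Fin p)}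
    {Φ : (ℓ : Fin p) → ℝ → Matrix (S ℓ) (S ℓ) ℂ}
    (hΦ : ∀ ℓ, IsSpectrum P (subSignal (stack u e) (S ℓ)) (Φ ℓ)) (hpos : ∀ ℓ, PosDefAE (Φ ℓ))
    (hS : ∀ ℓ, ∀ j ∉ S ℓ, combined G H ℓ j = combined G0 H0 ℓ j)
    (hnull : ∀ i, matFilter (mismatch G0 G H0 H) K i ∈ nullSubmodule (Lp ℝ 2 P)) :
    combined G H = combined G0 H0 := by
  have hdiff := h0.isStable_combined.sub h.isStable_combined
  have hrow (ℓ : Fin p) :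
      ∑ j, filterCLM ((combined G0 H0 - combined G H) ℓ j) (K j) ∈ nullSubmodule (Lp ℝ 2 P) := by
    rw [← matFilter_apply, ← mul_mismatch h, matFilter_mul h.stable_H (isStable_mismatch h0 h)]
    exact matFilter_mem_nullSubmodule h.stable_H hnull ℓ
  refine (sub_eq_zero.1 (funext fun ℓ => ?_)).symm
  exact eq_zero_of_mem_nullSubmodule_of_support hK (hΦ ℓ) (hpos ℓ) (hdiff ℓ)
    (fun j hj => sub_eq_zero.2 (hS ℓ j hj).symm) (hrow ℓ)

end PredictionError

theorem eq_of_notMem_rowSupport {n p : ℕ} {κ : Type*} {Θ : Set (Fin n → ℝ)}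
    {M : (Fin n → ℝ) → Matrix (Fin p) κ TF} {M0 : Matrix (Fin p) κ TF}
    (hM0 : ∃ θ₀ ∈ Θ, M θ₀ = M0) {θ : Fin n → ℝ} (hθ : θ ∈ Θ) {ℓ : Fin p} {j : κ}
    (hj : j ∉ rowSupport Θ M ℓ) : M θ ℓ j = M0 ℓ j := by
  obtain ⟨θ₀, hθ₀, rfl⟩ := hM0
  have hzero : ∀ θ ∈ Θ, M θ ℓ j = 0 := by simpa [rowSupport] using hj
  rw [hzero θ hθ, hzero θ₀ hθ₀]

end PredErr

open PredErr in
theorem proposition1_general {Ω : Type*} [MeasurableSpace Ω] (P : Measure Ω) {p m : ℕ}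
    (G0 : Matrix (Fin p) (Fin m) TF) (H0 : Matrix (Fin p) (Fin p) TF)
    (h0 : IsAdmissible G0 H0)
    (u : Signal Ω (Fin m)) (e y : Signal Ω (Fin p))
    (hqs : IsQuasiStationary P (stack u e))
    (hwhite : IsWhite P e)
    (hue : IsUncorrelatedWithPast P e u)
    (hy : ∀ t, ∀ᵐ ω ∂P, y t ω = filt G0 u t ω + filt H0 e t ω)
    {𝓜 : Type*} (Θ : Set 𝓜)
    (G : 𝓜 → Matrix (Fin p) (Fin m) TF) (H : 𝓜 → Matrix (Fin p) (Fin p) TF)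
    (hmodel : ∀ θ ∈ Θ, IsAdmissible (G θ) (H θ))
    (hsys : ∃ θ₀ ∈ Θ, combined (G θ₀) (H θ₀) = combined G0 H0)
    (Q : Matrix (Fin p) (Fin p) ℝ) (hQ : Q.PosDef)
    (S : Fin p → Set (Fin m ⊕ Fin p))
    (hS : ∀ θ ∈ Θ, ∀ ℓ, ∀ j ∉ S ℓ, combined (G θ) (H θ) ℓ j = combined G0 H0 ℓ j)
    (Φ : (ℓ : Fin p) → ℝ → Matrix (S ℓ) (S ℓ) ℂ)
    (hΦ : ∀ ℓ, IsSpectrum P (subSignal (stack u e) (S ℓ)) (Φ ℓ))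
    (hpos : ∀ ℓ, PosDefAE (Φ ℓ)) :
    ∃ V : 𝓜 → ℝ,
      (∀ θ ∈ Θ, HasGenExp P
        (fun t ω => predictionError (G θ) (H θ) y u t ω ⬝ᵥ
          Q *ᵥ predictionError (G θ) (H θ) y u t ω) (V θ)) ∧
      ∀ θ ∈ Θ, IsMinOn V Θ θ ↔ combined (G θ) (H θ) = combined G0 H0 := by
  obtain ⟨θ₀, hθ₀, hM0⟩ := hsys
  obtain ⟨K, hK⟩ := hqs.exists_represents
  obtain ⟨R, hR⟩ := hqs.correlation
  obtain ⟨c, hc⟩ := exists_hasMeanForm Q fun i j =>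
    ⟨_, (hR.hasCorrelation hK (Sum.inr i) (Sum.inr j)).hasMeanInner⟩
  choose! V hV hcV hVc using fun θ hθ => exists_hasGenExp_predictionError hQ hK
    (fun i j => ⟨_, hR.hasCorrelation hK i j⟩) h0 (hmodel θ hθ) hwhite hue hy hc
  have heq (θ) (hθ : θ ∈ Θ) :
      V θ = c ↔ combined (G θ) (H θ) = combined G0 H0 :=
    (hVc θ hθ).trans ⟨combined_eq_of_mismatch_mem_nullSubmodule hK h0 (hmodel θ hθ)
      hΦ hpos (hS θ hθ), fun hM i => by simp [mismatch, hM, matFilter_apply]⟩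
  refine ⟨V, hV, fun θ hθ => ⟨fun hmin => ?_, fun hM => isMinOn_iff.2 fun θ' hθ' => ?_⟩⟩
  · have hle : V θ ≤ c := (isMinOn_iff.1 hmin θ₀ hθ₀).trans_eq ((heq θ₀ hθ₀).2 hM0)
    exact (heq θ hθ).1 (hle.antisymm (hcV θ hθ))
  · exact ((heq θ hθ).2 hM).trans_le (hcV θ' hθ')

theorem proposition1 {Ω : Type*} [MeasurableSpace Ω] (P : MeasureTheory.Measure Ω)
    [MeasureTheory.IsProbabilityMeasure P] {p m n : ℕ}
    -- the data generating system `y = G⁰ u + H⁰ e`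
    (G0 : Matrix (Fin p) (Fin m) PredErr.TF) (H0 : Matrix (Fin p) (Fin p) PredErr.TF)
    (h0 : PredErr.IsAdmissible G0 H0)
    (u : PredErr.Signal Ω (Fin m)) (e y : PredErr.Signal Ω (Fin p))
    (hqs : PredErr.IsQuasiStationary P (PredErr.stack u e))
    (hwhite : PredErr.IsWhite P e)
    (hue : PredErr.IsUncorrelatedWithPast P e u)
    (hy : ∀ t, ∀ᵐ ω ∂P, y t ω = PredErr.filt G0 u t ω + PredErr.filt H0 e t ω)
    -- the parametrized model set, containing the system
    (Θ : Set (Fin n → ℝ))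
    (G : (Fin n → ℝ) → Matrix (Fin p) (Fin m) PredErr.TF)
    (H : (Fin n → ℝ) → Matrix (Fin p) (Fin p) PredErr.TF)
    (hmodel : ∀ θ ∈ Θ, PredErr.IsAdmissible (G θ) (H θ))
    (hsys : ∃ θ₀ ∈ Θ, PredErr.combined (G θ₀) (H θ₀) = PredErr.combined G0 H0)
    (hrows : PredErr.IndependentRows Θ fun θ => PredErr.combined (G θ) (H θ))
    -- the weighting matrix of the cost function
    (Q : Matrix (Fin p) (Fin p) ℝ) (hQ : Q.PosDef)
    -- the spectra of the signals entering the nonzero entries of each row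
    (Φ : (ℓ : Fin p) → ℝ →
      Matrix (PredErr.rowSupport Θ (fun θ => PredErr.combined (G θ) (H θ)) ℓ)
        (PredErr.rowSupport Θ (fun θ => PredErr.combined (G θ) (H θ)) ℓ) ℂ)
    (hΦ : ∀ ℓ, PredErr.IsSpectrum P
      (PredErr.subSignal (PredErr.stack u e)
        (PredErr.rowSupport Θ (fun θ => PredErr.combined (G θ) (H θ)) ℓ)) (Φ ℓ))
    (hpos : ∀ ℓ, PredErr.PosDefAE (Φ ℓ)) :
    ∃ V : (Fin n → ℝ) → ℝ,
      (∀ θ ∈ Θ, PredErr.HasGenExp P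
        (fun t ω => PredErr.predictionError (G θ) (H θ) y u t ω ⬝ᵥ
          Q *ᵥ PredErr.predictionError (G θ) (H θ) y u t ω) (V θ)) ∧
      ∀ θ ∈ Θ, IsMinOn V Θ θ ↔
        PredErr.combined (G θ) (H θ) = PredErr.combined G0 H0 := by
  exact proposition1_general P G0 H0 h0 u e y hqs hwhite hue hy Θ G H hmodel hsys Q hQ _
    (fun _ hθ _ _ => PredErr.eq_of_notMem_rowSupport hsys hθ) Φ hΦ hpos
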